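/- For a group $G$, the undirected Cayley graph $\Gamma(G;S)$ with respect to $S\subseteq G$ has vertex set $G$, with distinct $g,h\in G$ adjacent if and only if $g^{-1}h\in S$ or $h^{-1}g\in S$. For $p\in[0,1]$, the model $\mathcal{G}(G,p)$ is the probability space of the graphs $\Gamma(G;S)$ in which every element of $G$ belongs to $S$ independently with probability $p$. The diameter of a disconnected graph is $\infty$. For a real number $\gamma\in(0,1)$ let $$d_N=(1-\gamma)\sqrt{\frac{\log N}{2\log\log N}}.$$ **Theorem 4.** Fix $\varepsilon>0$ and $\gamma\in(0,1)$. Let $n\in\mathbb{N}$, $G=\mathbb{Z}_2^n$, $N=2^n=|G|$, and let $d\in\mathbb{N}$ with $2\leqslant d\leqslant d_N$. If $\Gamma\in\mathcal{G}(G,p)$, where $$p\leqslant\sqrt[d]{d!\,(1-\varepsilon)\frac{\log N}{N^{d-1}}},\qquad\text{that is,}\qquad p^d\leqslant d!\,(1-\varepsilon)\frac{\log N}{N^{d-1}},$$ then with high probability the diameter of $\Gamma$ is greater than $d$. Here "with high probability" means that the probability that the diameter is at most $d$ tends to $0$ as $n\to\infty$, uniformly over all such $d$ and $p$: for every $\eta>0$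 there is $n_0=n_0(\varepsilon,\gamma,\eta)$ such that for all $n\geqslant n_0$ and all $d$ and $p\in[0,1]$ as above, the diameter of $\Gamma$ is greater than $d$ with probability at least $1-\eta$. -/

import Mathlib

open MeasureTheory ProbabilityTheory
open scoped unitInterval Nat

noncomputable section

/-- The model `𝒢(G, p)` for a group `G` written additively: the law of the (undirected, loopless)
Cayley graph of `G` with respect to a random set `S ⊆ G` which contains each element of `G`
independently with probability `p`. -/
def randomCayley (G : Type*) [AddGroup G] (p : I) : Measure (SimpleGraph G) :=
  (setBernoulli (Set.univ : Set G) p).map fun S => SimpleGraph.addCayley S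

/-- On a finite group every set of generators is an atom, so the push-forward above is not
degenerate. -/
theorem measurable_addCayley (G : Type*) [AddGroup G] [Finite G] :
    Measurable fun S : Set G => SimpleGraph.addCayley S :=
  Measurable.of_discrete

instance isProbabilityMeasure_randomCayley (G : Type*) [AddGroup G] [Finite G] (p : I) :
    IsProbabilityMeasure (randomCayley G p) :=
  Measure.isProbabilityMeasure_map (measurable_addCayley G).aemeasurable

/-- The bound `d_N = (1 - γ) √(log N / (2 log log N))` on the diameters under consideration. -/
def diamBound (γ N : ℝ) : ℝ :=
  (1 - γ) * √(Real.log N / (2 * Real.log (Real.log N)))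

end

/-! In $\mathbb{Z}_2^n$ a walk from $0$ to $v$ yields, after cancelling repeated steps, a set of
generators with sum $v$. So diameter at most $d$ forces every $v$ to be a sum of at most $d$
elements of the random set $S$; call $v$ missed if it is not. For $v\neq 0$ the expected number
$\mu_v$ of subsets of $S$ with at most $d$ elements and sum $v$ is at most
$(pN)^d/(N\,d!)+o(1)\le(1-\varepsilon)\log N+o(1)$. By Harris's inequality
(`prod_le_bernoulliExp_avoidInd`) $v$ is missed with probability at least about
$N^{-(1-\varepsilon)}$, so the expected number of missed vertices is at least about
$N^{\varepsilon}$.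

The second moment method (`bernoulliExp_prod_one_sub_le`) then shows that some vertex is missed.
Janson's inequality (`bernoulliExp_avoidInd_le`), applied to the families of $u$ and $v$ together,
bounds the probability that both are missed by $e^{-\mu_u-\mu_v+\Delta}$, which matches the product
of the Harris lower bounds up to a factor $1+o(1)$. Here $\Delta$ is small because a set that
overlaps a given one has fewer than $d$ free elements, and $(pN)^m/N\le\kappa=d!\,\log N/N^{1/d}$
for $m<d$. The upper bound on $d$ makes $2^d d\,\kappa\log N$ tend to $0$
(`two_pow_mul_factorial_div_exp_le`). -/

/-! ### Random subsets: correlation inequalities and the second moment -/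

open Finset in
/-- The expectation of `f S` for a random subset `S` of `ι` which contains each element of `ι`
independently with probability `p`. -/
def bernoulliExp {ι : Type*} [Fintype ι] [DecidableEq ι] (p : ℝ) (f : Finset ι → ℝ) : ℝ :=
  ∑ S, p ^ #S * (1 - p) ^ #Sᶜ * f S

/-- The indicator of the event that the random set contains `T`. -/
def containsInd {ι : Type*} [DecidableEq ι] (T S : Finset ι) : ℝ := if T ⊆ S then 1 else 0

/-- The indicator of the event that the random set contains no member of `F`. -/
def avoidInd {ι : Type*} [DecidableEq ι] (F : Finset (Finset ι)) (S : Finset ι) : ℝ :=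
  ∏ T ∈ F, (1 - containsInd T S)

section
open Finset

variable {ι : Type*} [DecidableEq ι]

theorem containsInd_nonneg (T S : Finset ι) : 0 ≤ containsInd T S := by
  unfold containsInd; split_ifs <;> norm_num

theorem containsInd_le_one (T S : Finset ι) : containsInd T S ≤ 1 := by
  unfold containsInd; split_ifs <;> norm_num

theorem containsInd_monotone (T : Finset ι) : Monotone (containsInd T) := by
  intro A B h
  unfold containsInd
  split_ifs with h₁ h₂ <;> try norm_num
  exact h₂ (h₁.trans h)

theorem containsInd_union (T T' S : Finset ι) :
    containsInd (T ∪ T') S = containsInd T S * containsInd T' S := by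
  simp only [containsInd, union_subset_iff]
  split_ifs <;> simp_all

theorem avoidInd_nonneg (F : Finset (Finset ι)) (S : Finset ι) : 0 ≤ avoidInd F S :=
  prod_nonneg fun T _ => sub_nonneg.2 (containsInd_le_one T S)

theorem avoidInd_le_one (F : Finset (Finset ι)) (S : Finset ι) : avoidInd F S ≤ 1 :=
  prod_le_one (fun T _ => sub_nonneg.2 (containsInd_le_one T S))
    fun T _ => sub_le_self _ (containsInd_nonneg T S)

theorem avoidInd_antitone (F : Finset (Finset ι)) : Antitone (avoidInd F) := fun _ _ h =>
  prod_le_prod (fun T _ => sub_nonneg.2 (containsInd_le_one T _))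
    fun T _ => sub_le_sub_left (containsInd_monotone T h) 1

theorem avoidInd_empty : avoidInd (∅ : Finset (Finset ι)) = fun _ => 1 := rfl

theorem avoidInd_insert {F : Finset (Finset ι)} {T : Finset ι} (h : T ∉ F) (S : Finset ι) :
    avoidInd (insert T F) S = (1 - containsInd T S) * avoidInd F S := by
  simp [avoidInd, prod_insert h]

theorem avoidInd_union {F F' : Finset (Finset ι)} (h : Disjoint F F') (S : Finset ι) :
    avoidInd (F ∪ F') S = avoidInd F S * avoidInd F' S := by
  simp [avoidInd, prod_union h]

theorem one_sub_sum_containsInd_le_avoidInd (F : Finset (Finset ι)) (S : Finset ι) :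
    1 - ∑ T ∈ F, containsInd T S ≤ avoidInd F S := by
  induction F using Finset.induction_on with
  | empty => simp [avoidInd]
  | insert T F h ih =>
    rw [avoidInd_insert h, sum_insert h]
    nlinarith [avoidInd_le_one F S, containsInd_nonneg T S, avoidInd_nonneg F S]

theorem avoidInd_eq_one_or_zero (F : Finset (Finset ι)) (S : Finset ι) :
    ((∀ T ∈ F, ¬ T ⊆ S) ∧ avoidInd F S = 1) ∨ avoidInd F S = 0 := by
  by_cases h : ∀ T ∈ F, ¬ T ⊆ S
  · refine Or.inl ⟨h, prod_eq_one fun T hT => ?_⟩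
    simp [containsInd, h T hT]
  · push Not at h
    obtain ⟨T, hT, hS⟩ := h
    exact Or.inr (prod_eq_zero hT (by simp [containsInd, hS]))

theorem avoidInd_insert_right {F : Finset (Finset ι)} {x : ι} (h : ∀ T ∈ F, x ∉ T)
    (S : Finset ι) : avoidInd F (insert x S) = avoidInd F S := by
  refine prod_congr rfl fun T hT => ?_
  simp [containsInd, subset_insert_iff_of_notMem (h T hT)]

variable [Fintype ι] {p : ℝ}

theorem bernoulliExp_add (f g : Finset ι → ℝ) :
    bernoulliExp p (fun S => f S + g S) = bernoulliExp p f + bernoulliExp p g := by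
  simp [bernoulliExp, mul_add, sum_add_distrib]

theorem bernoulliExp_sub (f g : Finset ι → ℝ) :
    bernoulliExp p (fun S => f S - g S) = bernoulliExp p f - bernoulliExp p g := by
  simp [bernoulliExp, mul_sub, sum_sub_distrib]

theorem bernoulliExp_const_mul (c : ℝ) (f : Finset ι → ℝ) :
    bernoulliExp p (fun S => c * f S) = c * bernoulliExp p f := by
  rw [bernoulliExp, bernoulliExp, mul_sum]
  exact sum_congr rfl fun S _ => by ring

theorem bernoulliExp_sum {α : Type*} (A : Finset α) (f : α → Finset ι → ℝ) :
    bernoulliExp p (fun S => ∑ a ∈ A, f a S) = ∑ a ∈ A, bernoulliExp p (f a) := by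
  simp only [bernoulliExp, mul_sum]
  exact sum_comm

theorem bernoulliExp_one : bernoulliExp p (fun _ : Finset ι => 1) = 1 := by
  have := Fintype.sum_pow_mul_eq_add_pow ι p (1 - p)
  simp only [add_sub_cancel, one_pow] at this
  simpa [bernoulliExp, card_compl] using this

theorem bernoulliExp_mono (h₀ : 0 ≤ p) (h₁ : p ≤ 1) {f g : Finset ι → ℝ} (h : ∀ S, f S ≤ g S) :
    bernoulliExp p f ≤ bernoulliExp p g :=
  sum_le_sum fun S _ => mul_le_mul_of_nonneg_left (h S)
    (mul_nonneg (pow_nonneg h₀ _) (pow_nonneg (sub_nonneg.2 h₁) _))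

theorem bernoulliExp_nonneg (h₀ : 0 ≤ p) (h₁ : p ≤ 1) {f : Finset ι → ℝ} (h : ∀ S, 0 ≤ f S) :
    0 ≤ bernoulliExp p f :=
  sum_nonneg fun S _ => mul_nonneg
    (mul_nonneg (pow_nonneg h₀ _) (pow_nonneg (sub_nonneg.2 h₁) _)) (h S)

/-- Harris's inequality for two increasing functions. -/
theorem bernoulliExp_mul_le_of_monotone (h₀ : 0 ≤ p) (h₁ : p ≤ 1) {f g : Finset ι → ℝ}
    (hf₀ : ∀ S, 0 ≤ f S) (hg₀ : ∀ S, 0 ≤ g S) (hf : Monotone f) (hg : Monotone g) :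
    bernoulliExp p f * bernoulliExp p g ≤ bernoulliExp p fun S => f S * g S := by
  have h := fkg (μ := fun S : Finset ι => p ^ #S * (1 - p) ^ #Sᶜ) (f := f) (g := g)
    (fun S => mul_nonneg (pow_nonneg h₀ _) (pow_nonneg (sub_nonneg.2 h₁) _)) hf₀ hg₀ hf hg
    (fun A B => by
      -- The weight is a product over elements, so the lattice condition of `fkg` is an equality.
      apply le_of_eq
      have e₁ : #(A ∩ B) + #(A ∪ B) = #A + #B := card_inter_add_card_union A B
      have e₂ : #(A ∩ B)ᶜ + #(A ∪ B)ᶜ = #Aᶜ + #Bᶜ := by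
        rw [compl_inter, compl_union, add_comm]
        exact card_inter_add_card_union _ _
      simp only [inf_eq_inter, sup_eq_union]
      calc _ = p ^ (#A + #B) * (1 - p) ^ (#Aᶜ + #Bᶜ) := by ring
        _ = _ := by rw [← e₁, ← e₂]; ring)
  have h₁ := bernoulliExp_one (ι := ι) (p := p)
  simp only [bernoulliExp, mul_one] at h₁
  rw [h₁, one_mul] at h
  exact h

/-- Harris's inequality for an increasing and a decreasing function. -/
theorem bernoulliExp_mul_le_of_antitone (h₀ : 0 ≤ p) (h₁ : p ≤ 1) {f g : Finset ι → ℝ}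
    (hf₀ : ∀ S, 0 ≤ f S) (hg₁ : ∀ S, g S ≤ 1) (hf : Monotone f) (hg : Antitone g) :
    bernoulliExp p (fun S => f S * g S) ≤ bernoulliExp p f * bernoulliExp p g := by
  have h := bernoulliExp_mul_le_of_monotone h₀ h₁ hf₀ (g := fun S => 1 - g S)
    (fun S => sub_nonneg.2 (hg₁ S)) hf fun _ _ h => sub_le_sub_left (hg h) 1
  simp only [mul_sub, mul_one, bernoulliExp_sub, bernoulliExp_one] at h
  linarith

/-- Harris's inequality for two decreasing functions. -/
theorem mul_bernoulliExp_le_of_antitone (h₀ : 0 ≤ p) (h₁ : p ≤ 1) {f g : Finset ι → ℝ}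
    (hf₁ : ∀ S, f S ≤ 1) (hg₁ : ∀ S, g S ≤ 1) (hf : Antitone f) (hg : Antitone g) :
    bernoulliExp p f * bernoulliExp p g ≤ bernoulliExp p fun S => f S * g S := by
  have h := bernoulliExp_mul_le_of_antitone h₀ h₁ (f := fun S => 1 - f S)
    (fun S => sub_nonneg.2 (hf₁ S)) hg₁ (fun _ _ h => sub_le_sub_left (hf h) 1) hg
  simp only [sub_mul, one_mul, bernoulliExp_sub, bernoulliExp_one] at h
  linarith

/-- Deleting $x$ pairs the sets with and without $x$ and preserves $g$, so $(1-p)A=pB$, whence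
$A=p(A+B)$. -/
theorem bernoulliExp_containsInd_singleton_mul {x : ι} {g : Finset ι → ℝ}
    (hg : ∀ S, g (insert x S) = g S) :
    bernoulliExp p (fun S => containsInd {x} S * g S) = p * bernoulliExp p g := by
  set A := ∑ S with x ∈ S, p ^ #S * (1 - p) ^ #Sᶜ * g S with hA
  set B := ∑ S with x ∉ S, p ^ #S * (1 - p) ^ #Sᶜ * g S with hB
  have e₁ : bernoulliExp p (fun S => containsInd {x} S * g S) = A := by
    rw [hA, sum_filter, bernoulliExp]
    refine sum_congr rfl fun S _ => ?_
    by_cases h : x ∈ S <;> simp [containsInd, h]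
  have e₂ : bernoulliExp p g = A + B := (sum_filter_add_sum_filter_not univ _ _).symm
  have e₃ : (1 - p) * A = p * B := by
    rw [hA, hB, mul_sum, mul_sum]
    refine sum_bij' (fun S _ => S.erase x) (fun S _ => insert x S) (by simp) (by simp)
      (fun S hS => insert_erase (mem_filter.1 hS).2)
      (fun S hS => erase_insert (mem_filter.1 hS).2) fun S hS => ?_
    have hx := (mem_filter.1 hS).2
    have e₄ : g S = g (S.erase x) := by rw [← hg (S.erase x), insert_erase hx]
    have e₅ : #S = #(S.erase x) + 1 := (card_erase_add_one hx).symm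
    have e₆ : #(S.erase x)ᶜ = #Sᶜ + 1 := by
      rw [compl_erase, card_insert_of_notMem (by simpa using hx)]
    rw [e₄, e₅, e₆]
    ring
  rw [e₁, e₂]
  linarith

theorem bernoulliExp_containsInd_mul {T : Finset ι} {g : Finset ι → ℝ}
    (hg : ∀ x ∈ T, ∀ S, g (insert x S) = g S) :
    bernoulliExp p (fun S => containsInd T S * g S) = p ^ #T * bernoulliExp p g := by
  induction T using Finset.induction_on with
  | empty => simp [containsInd]
  | insert x T hx ih =>
    have e : (fun S => containsInd (insert x T) S * g S)
        = fun S => containsInd {x} S * (containsInd T S * g S) := by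
      funext S
      rw [insert_eq, containsInd_union, mul_assoc]
    rw [e, bernoulliExp_containsInd_singleton_mul, ih fun y hy => hg y (mem_insert_of_mem hy),
      card_insert_of_notMem hx, pow_succ]
    · ring
    · intro S
      rw [hg x (mem_insert_self x T)]
      simp [containsInd, subset_insert_iff_of_notMem hx]

theorem bernoulliExp_containsInd (T : Finset ι) :
    bernoulliExp p (containsInd T) = p ^ #T := by
  have h := bernoulliExp_containsInd_mul (p := p) (T := T) (g := fun _ => 1) fun _ _ _ => rfl
  simpa [bernoulliExp_one] using h

/-- Avoiding each $T$ is a decreasing event, and decreasing events are positively correlated. -/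
theorem prod_le_bernoulliExp_avoidInd (h₀ : 0 ≤ p) (h₁ : p ≤ 1) (F : Finset (Finset ι)) :
    ∏ T ∈ F, (1 - p ^ #T) ≤ bernoulliExp p (avoidInd F) := by
  induction F using Finset.induction_on with
  | empty => simp [avoidInd_empty, bernoulliExp_one]
  | insert T F h ih =>
    have e : avoidInd (insert T F) = fun S => (1 - containsInd T S) * avoidInd F S :=
      funext (avoidInd_insert h)
    have h₂ := mul_bernoulliExp_le_of_antitone h₀ h₁ (f := fun S => 1 - containsInd T S)
      (fun S => sub_le_self _ (containsInd_nonneg T S)) (avoidInd_le_one F)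
      (fun _ _ h => sub_le_sub_left (containsInd_monotone T h) 1) (avoidInd_antitone F)
    rw [bernoulliExp_sub, bernoulliExp_one, bernoulliExp_containsInd] at h₂
    rw [e, prod_insert h]
    exact (mul_le_mul_of_nonneg_left ih (sub_nonneg.2 (pow_le_one₀ h₀ h₁))).trans h₂

/-- The dependency term of Janson's inequality: the sum over the pairs of distinct intersecting
members of `F`, the second one not larger than the first, of the probability that both of them
are contained in the random set. -/
def jansonSum (p : ℝ) (F : Finset (Finset ι)) : ℝ :=
  ∑ T ∈ F, ∑ T' ∈ F with T' ≠ T ∧ #T' ≤ #T ∧ ¬ Disjoint T T', p ^ #(T ∪ T')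

/-- **Janson's inequality**. -/
theorem bernoulliExp_avoidInd_le (h₀ : 0 ≤ p) (h₁ : p ≤ 1) (F : Finset (Finset ι)) :
    bernoulliExp p (avoidInd F) ≤ Real.exp (-∑ T ∈ F, p ^ #T + jansonSum p F) := by
  -- Members are added in order of size, so every intersecting pair of the new $T$ and an earlier
  -- member is counted by `jansonSum`.
  induction F using Finset.induction_on_max_value (fun T : Finset ι => #T) with
  | empty => simp [avoidInd_empty, bernoulliExp_one, jansonSum]
  | insert T F hT hmax ih =>
    set D := F.filter fun T' => Disjoint T T' with hD
    set C := F.filter fun T' => ¬ Disjoint T T' with hC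
    set s := ∑ T' ∈ C, p ^ #(T ∪ T') with hs
    have hDC : ∀ S, avoidInd F S = avoidInd D S * avoidInd C S := fun S =>
      (prod_filter_mul_prod_filter_not F _ _).symm
    have hD₀ : 0 ≤ bernoulliExp p (avoidInd D) := bernoulliExp_nonneg h₀ h₁ (avoidInd_nonneg D)
    have hF₀ : 0 ≤ bernoulliExp p (avoidInd F) := bernoulliExp_nonneg h₀ h₁ (avoidInd_nonneg F)
    have hFD : bernoulliExp p (avoidInd F) ≤ bernoulliExp p (avoidInd D) :=
      bernoulliExp_mono h₀ h₁ fun S => by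
        rw [hDC]; exact mul_le_of_le_one_right (avoidInd_nonneg D S) (avoidInd_le_one C S)
    -- Containing $T$ is independent of avoiding $D$. The members of $C$ are handled by a union
    -- bound, and Harris bounds each resulting term.
    have key : (p ^ #T - s) * bernoulliExp p (avoidInd D) ≤
        bernoulliExp p fun S => containsInd T S * avoidInd F S := by
      have k₁ : bernoulliExp p (fun S => containsInd T S * avoidInd D S
            - ∑ T' ∈ C, containsInd (T ∪ T') S * avoidInd D S) ≤
          bernoulliExp p fun S => containsInd T S * avoidInd F S := by
        refine bernoulliExp_mono h₀ h₁ fun S => ?_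
        have := mul_le_mul_of_nonneg_left (one_sub_sum_containsInd_le_avoidInd C S)
          (mul_nonneg (containsInd_nonneg T S) (avoidInd_nonneg D S))
        simp only [containsInd_union, hDC]
        rw [← sum_mul, ← mul_sum]
        linarith
      rw [bernoulliExp_sub, bernoulliExp_sum, bernoulliExp_containsInd_mul] at k₁
      · refine le_trans ?_ k₁
        rw [sub_mul, hs, sum_mul]
        refine sub_le_sub_left (sum_le_sum fun T' _ => ?_) _
        rw [← bernoulliExp_containsInd (p := p) (T ∪ T')]
        exact bernoulliExp_mul_le_of_antitone h₀ h₁ (containsInd_nonneg _) (avoidInd_le_one D)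
          (containsInd_monotone _) (avoidInd_antitone D)
      · intro x hx S
        exact avoidInd_insert_right (fun T' hT' =>
          disjoint_left.1 (mem_filter.1 hT').2 hx) S
    have key₂ : (p ^ #T - s) * bernoulliExp p (avoidInd F) ≤
        bernoulliExp p fun S => containsInd T S * avoidInd F S := by
      rcases le_total 0 (p ^ #T - s) with h | h
      · exact (mul_le_mul_of_nonneg_left hFD h).trans key
      · exact (mul_nonpos_of_nonpos_of_nonneg h hF₀).trans <| bernoulliExp_nonneg h₀ h₁
          fun S => mul_nonneg (containsInd_nonneg T S) (avoidInd_nonneg F S)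
    have e : bernoulliExp p (avoidInd (insert T F)) = bernoulliExp p (avoidInd F)
        - bernoulliExp p (fun S => containsInd T S * avoidInd F S) := by
      rw [← bernoulliExp_sub]
      exact congrArg _ (funext fun S => by rw [avoidInd_insert hT]; ring)
    have hJ : jansonSum p F + s ≤ jansonSum p (insert T F) := by
      rw [jansonSum, jansonSum, sum_insert hT, add_comm]
      refine add_le_add (sum_le_sum_of_subset_of_nonneg ?_ fun _ _ _ => pow_nonneg h₀ _)
        (sum_le_sum fun T' _ => sum_le_sum_of_subset_of_nonneg ?_ fun _ _ _ => pow_nonneg h₀ _)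
      · intro T' hT'
        rw [mem_filter] at hT' ⊢
        exact ⟨mem_insert_of_mem hT'.1, fun h => hT (h ▸ hT'.1), hmax T' hT'.1, hT'.2⟩
      · exact filter_subset_filter _ (subset_insert _ _)
    calc bernoulliExp p (avoidInd (insert T F))
        ≤ (1 - (p ^ #T - s)) * bernoulliExp p (avoidInd F) := by rw [e]; linarith
      _ ≤ Real.exp (-(p ^ #T - s)) * bernoulliExp p (avoidInd F) := by
        refine mul_le_mul_of_nonneg_right ?_ hF₀
        have := Real.add_one_le_exp (-(p ^ #T - s))
        linarith
      _ ≤ Real.exp (-(p ^ #T - s)) * Real.exp (-∑ T ∈ F, p ^ #T + jansonSum p F) :=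
        mul_le_mul_of_nonneg_left ih (Real.exp_nonneg _)
      _ ≤ _ := by
        rw [← Real.exp_add, sum_insert hT]
        exact Real.exp_le_exp.2 (by linarith)

/-- The second moment method for indicator functions which are pairwise almost uncorrelated. -/
theorem bernoulliExp_prod_one_sub_le (h₀ : 0 ≤ p) (h₁ : p ≤ 1) {α : Type*} (A : Finset α)
    (X : α → Finset ι → ℝ) (hX : ∀ a S, X a S = 1 ∨ X a S = 0) {δ : ℝ} (hδ : 0 ≤ δ)
    (hcov : ∀ a ∈ A, ∀ b ∈ A, a ≠ b → bernoulliExp p (fun S => X a S * X b S) ≤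
      (1 + δ) * (bernoulliExp p (X a) * bernoulliExp p (X b)))
    (hpos : 0 < ∑ a ∈ A, bernoulliExp p (X a)) :
    bernoulliExp p (fun S => ∏ a ∈ A, (1 - X a S)) ≤
      (∑ a ∈ A, bernoulliExp p (X a))⁻¹ + δ := by
  classical
  set m := ∑ a ∈ A, bernoulliExp p (X a) with hm
  have hX₀ : ∀ a S, 0 ≤ X a S := fun a S => by rcases hX a S with h | h <;> simp [h]
  have hq₀ : ∀ a, 0 ≤ bernoulliExp p (X a) := fun a => bernoulliExp_nonneg h₀ h₁ (hX₀ a)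
  have hE₁ : bernoulliExp p (fun S => ∑ a ∈ A, X a S) = m := bernoulliExp_sum A X
  have hE₂ : bernoulliExp p (fun S => (∑ a ∈ A, X a S) * ∑ a ∈ A, X a S) ≤
      m + (1 + δ) * (m * m) := by
    have e : (fun S => (∑ a ∈ A, X a S) * ∑ a ∈ A, X a S) =
        fun S => ∑ a ∈ A, ∑ b ∈ A, X a S * X b S := funext fun S => sum_mul_sum _ _ _ _
    rw [e, bernoulliExp_sum]
    simp_rw [bernoulliExp_sum]
    -- The diagonal terms satisfy $X_a^2=X_a$ and contribute the $m$ in the second moment.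
    have hab : ∀ a ∈ A, ∀ b ∈ A, bernoulliExp p (fun S => X a S * X b S) ≤
        (if a = b then bernoulliExp p (X a) else 0) +
          (1 + δ) * (bernoulliExp p (X a) * bernoulliExp p (X b)) := by
      intro a ha b hb
      split_ifs with h
      · subst h
        have : (fun S => X a S * X a S) = X a := funext fun S => by
          rcases hX a S with h | h <;> simp [h]
        rw [this]
        have := mul_nonneg (hq₀ a) (hq₀ a)
        nlinarith
      · rw [zero_add]
        exact hcov a ha b hb h
    refine (sum_le_sum fun a ha => sum_le_sum fun b hb => hab a ha b hb).trans (le_of_eq ?_)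
    simp only [sum_add_distrib]
    congr 1
    · exact sum_congr rfl fun a ha => by simp [ha]
    · rw [hm, sum_mul_sum, mul_sum]
      exact sum_congr rfl fun a _ => (mul_sum _ _ _).symm
  -- Chebyshev, pointwise: if all $X_a$ vanish then $(\sum X_a-m)^2=m^2$.
  have hdev : m * m * bernoulliExp p (fun S => ∏ a ∈ A, (1 - X a S)) ≤
      bernoulliExp p fun S => (∑ a ∈ A, X a S) * (∑ a ∈ A, X a S)
        - 2 * m * (∑ a ∈ A, X a S) + m * m * 1 := by
    rw [← bernoulliExp_const_mul]
    refine bernoulliExp_mono h₀ h₁ fun S => ?_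
    by_cases h : ∃ a ∈ A, X a S = 1
    · obtain ⟨a, ha, h⟩ := h
      rw [prod_eq_zero ha (by simp [h])]
      nlinarith [sq_nonneg (∑ a ∈ A, X a S - m)]
    · have h' : ∀ a ∈ A, X a S = 0 := fun a ha =>
        (hX a S).resolve_left fun h' => h ⟨a, ha, h'⟩
      rw [sum_eq_zero h', prod_eq_one fun a ha => by rw [h' a ha, sub_zero]]
      simp
  rw [bernoulliExp_add, bernoulliExp_sub, bernoulliExp_const_mul, bernoulliExp_const_mul,
    bernoulliExp_one, hE₁] at hdev
  have hfin : m * m * bernoulliExp p (fun S => ∏ a ∈ A, (1 - X a S)) ≤ m + δ * (m * m) := by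
    linarith
  have hmm : 0 < m * m := mul_pos hpos hpos
  refine le_of_mul_le_mul_left (hfin.trans (le_of_eq ?_)) hmm
  field_simp

end

/-! ### Subsets of an abelian group with prescribed sum -/

section
open Finset

/-- The subsets of `G` with `b` elements whose sum is `w`. -/
def subsetsWithSum (G : Type*) [AddCommGroup G] [Fintype G] [DecidableEq G] (b : ℕ) (w : G) :
    Finset (Finset G) :=
  {B | #B = b ∧ ∑ x ∈ B, x = w}

/-- The subsets of `G` with at most `d` elements whose sum is `w`. -/
def smallSubsetsWithSum (G : Type*) [AddCommGroup G] [Fintype G] [DecidableEq G] (d : ℕ) (w : G) :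
    Finset (Finset G) :=
  {B | #B ≤ d ∧ ∑ x ∈ B, x = w}

variable {G : Type*} [AddCommGroup G] [Fintype G] [DecidableEq G]

/-- Mark an element of $B$ and erase it: the prescribed sum recovers it, so the marked sets inject
into the $(b-1)$-subsets. -/
theorem factorial_mul_card_subsetsWithSum_le {b : ℕ} (hb : 1 ≤ b) (w : G) :
    b ! * #(subsetsWithSum G b w) ≤ Fintype.card G ^ (b - 1) := by
  have h : b * #(subsetsWithSum G b w) ≤ (Fintype.card G).choose (b - 1) := by
    have e : #((subsetsWithSum G b w).sigma fun B => B) = b * #(subsetsWithSum G b w) := by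
      rw [card_sigma, sum_const_nat (m := b), mul_comm]
      intro B hB
      exact (mem_filter.1 hB).2.1
    rw [← e, ← card_univ, ← card_powersetCard]
    refine card_le_card_of_injOn (fun q => q.1.erase q.2) ?_ ?_
    · rintro ⟨B, x⟩ hq
      simp only [coe_sigma, Set.mem_sigma_iff, mem_coe, subsetsWithSum, mem_filter] at hq
      simp only [mem_coe, mem_powersetCard, subset_univ, true_and]
      rw [card_erase_of_mem hq.2, hq.1.2.1]
    · rintro ⟨B, x⟩ hq ⟨B', x'⟩ hq' heq
      simp only [coe_sigma, Set.mem_sigma_iff, mem_coe, subsetsWithSum, mem_filter] at hq hq'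
      simp only at heq
      have h₁ := add_sum_erase B (fun y => y) hq.2
      have h₂ := add_sum_erase B' (fun y => y) hq'.2
      rw [hq.1.2.2] at h₁
      rw [hq'.1.2.2, ← heq] at h₂
      have hx : x = x' := add_right_cancel (h₁.trans h₂.symm)
      subst hx
      have hB : B = B' := by rw [← insert_erase hq.2, heq, insert_erase hq'.2]
      subst hB
      rfl
  calc b ! * #(subsetsWithSum G b w)
      = (b - 1)! * (b * #(subsetsWithSum G b w)) := by
        rw [← Nat.mul_factorial_pred (by lia : b ≠ 0)]; ring
    _ ≤ (b - 1)! * (Fintype.card G).choose (b - 1) := Nat.mul_le_mul_left _ h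
    _ = (Fintype.card G).descFactorial (b - 1) :=
        (Nat.descFactorial_eq_factorial_mul_choose _ _).symm
    _ ≤ _ := Nat.descFactorial_le_pow _ _

theorem card_subsetsWithSum_mul_pow_le {p : ℝ} (h₀ : 0 ≤ p) {b : ℕ} (hb : 1 ≤ b) (w : G) :
    #(subsetsWithSum G b w) * p ^ b ≤
      (p * Fintype.card G) ^ b / (Fintype.card G * (b ! : ℝ)) := by
  have hN : (0 : ℝ) < Fintype.card G := by exact_mod_cast Fintype.card_pos
  have hf : (0 : ℝ) < b ! := by exact_mod_cast Nat.factorial_pos b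
  have h : (b ! : ℝ) * #(subsetsWithSum G b w) ≤ (Fintype.card G : ℝ) ^ (b - 1) := by
    exact_mod_cast factorial_mul_card_subsetsWithSum_le hb w
  rw [le_div_iff₀ (by positivity)]
  calc #(subsetsWithSum G b w) * p ^ b * (Fintype.card G * (b ! : ℝ))
      = (b ! * #(subsetsWithSum G b w)) * (p ^ b * Fintype.card G) := by ring
    _ ≤ (Fintype.card G : ℝ) ^ (b - 1) * (p ^ b * Fintype.card G) := by gcongr
    _ = _ := by
      obtain ⟨c, rfl⟩ : ∃ c, b = c + 1 := ⟨b - 1, by lia⟩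
      rw [mul_pow, Nat.add_sub_cancel]; ring

theorem card_subsetsWithSum_mul_pow_le_of_le {p κ : ℝ} (h₀ : 0 ≤ p) {d b : ℕ}
    (hκ : ∀ m ≤ d - 1, (p * Fintype.card G) ^ m ≤ κ * Fintype.card G) (hb : 1 ≤ b)
    (hbd : b ≤ d - 1) (w : G) : #(subsetsWithSum G b w) * p ^ b ≤ κ := by
  have hN : (0 : ℝ) < Fintype.card G := by exact_mod_cast Fintype.card_pos
  have hf : (1 : ℝ) ≤ b ! := by exact_mod_cast Nat.factorial_pos b
  refine (card_subsetsWithSum_mul_pow_le h₀ hb w).trans ?_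
  rw [div_le_iff₀ (by positivity)]
  have h₁ := hκ b hbd
  have h₂ : 0 ≤ κ * Fintype.card G := le_trans (by positivity) h₁
  nlinarith

/-- Size $d$ gives the main term; each of the $d-1$ smaller sizes costs only $\kappa$. Since
$v\ne0$, the empty set does not occur. -/
theorem sum_pow_card_smallSubsetsWithSum_le {p κ : ℝ} (h₀ : 0 ≤ p) {d : ℕ} (hd : 1 ≤ d)
    (hκ : ∀ m ≤ d - 1, (p * Fintype.card G) ^ m ≤ κ * Fintype.card G) {v : G} (hv : v ≠ 0) :
    ∑ T ∈ smallSubsetsWithSum G d v, p ^ #T ≤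
      (p * Fintype.card G) ^ d / (Fintype.card G * (d ! : ℝ)) + (d - 1 : ℕ) * κ := by
  have hmaps : ∀ T ∈ smallSubsetsWithSum G d v, #T ∈ Icc 1 d := by
    intro T hT
    have hT := (mem_filter.1 hT).2
    refine mem_Icc.2 ⟨card_pos.2 ?_, hT.1⟩
    rw [nonempty_iff_ne_empty]
    rintro rfl
    exact hv (by simpa using hT.2.symm)
  have hfib : ∀ b ∈ Icc 1 d, ∑ T ∈ smallSubsetsWithSum G d v with #T = b, p ^ #T =
      #(subsetsWithSum G b v) * p ^ b := by
    intro b hb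
    have e : (smallSubsetsWithSum G d v).filter (fun T => #T = b) = subsetsWithSum G b v := by
      ext T
      simp only [smallSubsetsWithSum, subsetsWithSum, mem_filter, mem_univ, true_and]
      have := (mem_Icc.1 hb).2
      constructor
      · rintro ⟨⟨_, h⟩, h'⟩; exact ⟨h', h⟩
      · rintro ⟨h', h⟩; exact ⟨⟨by lia, h⟩, h'⟩
    rw [e, ← nsmul_eq_mul]
    refine sum_eq_card_nsmul fun T hT => ?_
    rw [(mem_filter.1 hT).2.1]
  rw [← sum_fiberwise_of_maps_to hmaps, sum_congr rfl hfib]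
  obtain ⟨c, rfl⟩ : ∃ c, d = c + 1 := ⟨d - 1, by lia⟩
  rw [sum_Icc_succ_top hd, add_comm]
  refine add_le_add (card_subsetsWithSum_mul_pow_le h₀ hd v) ?_
  refine (sum_le_card_nsmul _ _ κ fun b hb => ?_).trans (le_of_eq ?_)
  · rw [mem_Icc] at hb
    exact card_subsetsWithSum_mul_pow_le_of_le h₀ hκ hb.1 (by lia) v
  · simp

/-- Classify $T$ by its trace on $T'$, its sum and the size of $T\setminus T'$. Within a class
$T\setminus T'$ determines $T$ and has a prescribed sum, so the class contributes at most $\kappa$.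
As $T'$ is the smaller set and meets $T$, that size lies between $1$ and $d-1$; a nested $T\subset
T'$ would contribute $p^0=1$. -/
theorem sum_pow_card_sdiff_le {p κ : ℝ} (h₀ : 0 ≤ p) {d : ℕ} (hd : 2 ≤ d)
    (hκ : ∀ m ≤ d - 1, (p * Fintype.card G) ^ m ≤ κ * Fintype.card G)
    {F : Finset (Finset G)} {W : Finset G} (hFd : ∀ T ∈ F, #T ≤ d)
    (hFW : ∀ T ∈ F, ∑ x ∈ T, x ∈ W) {T' : Finset G} (hT' : T' ∈ F) :
    ∑ T ∈ F with T' ≠ T ∧ #T' ≤ #T ∧ ¬ Disjoint T T', p ^ #(T \ T') ≤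
      2 ^ d * (#W * ((d - 1 : ℕ) * κ)) := by
  set key : Finset G → Finset G × G × ℕ := fun T => (T ∩ T', ∑ x ∈ T, x, #(T \ T')) with hkey
  set keys := T'.powerset ×ˢ W ×ˢ Icc 1 (d - 1) with hkeys
  set Q := F.filter fun T => T' ≠ T ∧ #T' ≤ #T ∧ ¬ Disjoint T T' with hQ
  have hκ₀ : 0 ≤ κ := by
    have hN : (0 : ℝ) < Fintype.card G := by exact_mod_cast Fintype.card_pos
    have := hκ 0 (by lia)
    rw [pow_zero] at this
    by_contra! h
    nlinarith
  have hmaps : ∀ T ∈ Q, key T ∈ keys := by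
    intro T hT
    obtain ⟨hTF, hne, hcard, hdisj⟩ := mem_filter.1 hT
    simp only [hkeys, hkey, mem_product, mem_powerset, mem_Icc]
    refine ⟨inter_subset_right, hFW T hTF, ?_, ?_⟩
    · rw [Nat.one_le_iff_ne_zero, card_ne_zero, sdiff_nonempty]
      exact fun h => hne (eq_of_subset_of_card_le h hcard).symm
    · have h₁ : 0 < #(T ∩ T') := by
        rw [card_pos, ← not_disjoint_iff_nonempty_inter]; exact hdisj
      have h₂ := card_sdiff_add_card_inter T T'
      have h₃ := hFd T hTF
      lia
  have hfib : ∀ k ∈ keys, ∑ T ∈ Q with key T = k, p ^ #(T \ T') ≤ κ := by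
    rintro ⟨C, w, b⟩ hk
    simp only [hkeys, mem_product, mem_Icc] at hk
    have hmem : ∀ T ∈ Q.filter (fun T => key T = (C, w, b)),
        T ∩ T' = C ∧ ∑ x ∈ T, x = w ∧ #(T \ T') = b := by
      intro T hT
      simpa [hkey] using (mem_filter.1 hT).2
    rw [sum_congr rfl fun T hT => by rw [(hmem T hT).2.2], sum_const, nsmul_eq_mul]
    refine le_trans ?_ (card_subsetsWithSum_mul_pow_le_of_le h₀ hκ hk.2.2.1 hk.2.2.2
      (w - ∑ x ∈ C, x))
    refine mul_le_mul_of_nonneg_right (Nat.cast_le.2 ?_) (pow_nonneg h₀ _)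
    refine card_le_card_of_injOn (fun T => T \ T') (fun T hT => ?_) fun T₁ h₁ T₂ h₂ h => ?_
    · obtain ⟨hC, hw, hb⟩ := hmem T hT
      simp only [subsetsWithSum, coe_filter, Set.mem_ofPred_eq, mem_univ, true_and]
      refine ⟨hb, ?_⟩
      rw [← hC, ← hw, eq_sub_iff_add_eq, add_comm]
      exact sum_inter_add_sum_sdiff T T' _
    · simp only at h
      rw [← sdiff_union_inter T₁ T', ← sdiff_union_inter T₂ T', h, (hmem T₁ h₁).1,
        (hmem T₂ h₂).1]
  rw [← sum_fiberwise_of_maps_to hmaps]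
  refine (sum_le_card_nsmul _ _ κ hfib).trans ?_
  rw [nsmul_eq_mul, hkeys, card_product, card_product, card_powerset, Nat.card_Icc,
    Nat.add_sub_cancel]
  push_cast
  rw [mul_assoc, mul_assoc]
  refine mul_le_mul_of_nonneg_right ?_ (by positivity)
  exact pow_le_pow_right₀ one_le_two (hFd T' hT')

theorem jansonSum_le {p κ : ℝ} (h₀ : 0 ≤ p) {d : ℕ} (hd : 2 ≤ d)
    (hκ : ∀ m ≤ d - 1, (p * Fintype.card G) ^ m ≤ κ * Fintype.card G)
    {F : Finset (Finset G)} {W : Finset G} (hFd : ∀ T ∈ F, #T ≤ d)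
    (hFW : ∀ T ∈ F, ∑ x ∈ T, x ∈ W) :
    jansonSum p F ≤ (∑ T ∈ F, p ^ #T) * (2 ^ d * (#W * ((d - 1 : ℕ) * κ))) := by
  rw [jansonSum, sum_mul]
  -- The smaller set goes outside, so that $p^{|T\cup T'|}$ splits as $p^{|T'|}p^{|T\setminus T'|}$.
  rw [sum_comm' (t' := F)
    (s' := fun T' => F.filter fun T => T' ≠ T ∧ #T' ≤ #T ∧ ¬ Disjoint T T')
    (fun T T' => by simp only [mem_filter]; tauto)]
  refine sum_le_sum fun T' hT' => ?_
  refine le_trans (le_of_eq ?_)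
    (mul_le_mul_of_nonneg_left (sum_pow_card_sdiff_le h₀ hd hκ hFd hFW hT') (pow_nonneg h₀ _))
  rw [mul_sum]
  refine sum_congr rfl fun T _ => ?_
  rw [← pow_add, ← card_sdiff_add_card T T', add_comm]

/-! ### From walks in the Cayley graph to subset sums -/

-- Each step is translation by an element of $S$; as $x+x=0$, a repeated generator is removed from
-- $T$ rather than added.
omit [Fintype G] in
theorem exists_subset_sum_eq_of_walk (hG : ∀ x : G, x + x = 0) {S : Set G} {u v : G}
    (q : (SimpleGraph.addCayley S).Walk u v) :
    ∃ T : Finset G, ↑T ⊆ S ∧ #T ≤ q.length ∧ ∑ x ∈ T, x = u + v := by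
  have hneg : ∀ x : G, -x = x := fun x => neg_eq_of_add_eq_zero_left (hG x)
  induction q with
  | nil => exact ⟨∅, by simp, by simp, by simp [hG]⟩
  | @cons u w v h q ih =>
    obtain ⟨T, hTS, hTc, hT⟩ := ih
    have hg : u + w ∈ S := by
      rw [SimpleGraph.addCayley_adj] at h
      simp only [hneg] at h
      rcases h.2 with h | h
      · exact h
      · rwa [add_comm]
    by_cases hgT : u + w ∈ T
    · refine ⟨T.erase (u + w), fun x hx => hTS (mem_of_mem_erase hx), ?_, ?_⟩
      · have := card_erase_le (s := T) (a := u + w)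
        rw [SimpleGraph.Walk.length_cons]
        lia
      · have h₁ := add_sum_erase T (fun y => y) hgT
        rw [hT] at h₁
        rw [eq_sub_of_add_eq' h₁, sub_eq_add_neg, hneg]
        calc w + v + (u + w) = u + v + (w + w) := by abel
          _ = u + v := by rw [hG, add_zero]
    · refine ⟨insert (u + w) T, ?_, ?_, ?_⟩
      · rw [coe_insert]
        exact Set.insert_subset hg hTS
      · rw [card_insert_of_notMem hgT, SimpleGraph.Walk.length_cons]
        lia
      · rw [sum_insert hgT, hT]
        calc u + w + (w + v) = u + v + (w + w) := by abel
          _ = u + v := by rw [hG, add_zero]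

theorem avoidInd_smallSubsetsWithSum_eq_zero_of_ediam_le (hG : ∀ x : G, x + x = 0) {d : ℕ}
    {S : Finset G} (h : (SimpleGraph.addCayley (S : Set G)).ediam ≤ d) (v : G) :
    avoidInd (smallSubsetsWithSum G d v) S = 0 := by
  refine (avoidInd_eq_one_or_zero _ S).resolve_left fun hav => ?_
  have hd : (SimpleGraph.addCayley (S : Set G)).edist 0 v ≤ d :=
    SimpleGraph.edist_le_ediam.trans h
  obtain ⟨q, hq⟩ := SimpleGraph.exists_walk_of_edist_ne_top
    (ne_top_of_le_ne_top (ENat.natCast_ne_top d) hd)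
  rw [← hq] at hd
  obtain ⟨T, hTS, hTc, hT⟩ := exists_subset_sum_eq_of_walk hG q
  refine hav.1 T ?_ (coe_subset.1 hTS)
  rw [zero_add] at hT
  exact mem_filter.2 ⟨mem_univ _, hTc.trans (by exact_mod_cast hd), hT⟩

/-- The σ-algebra on graphs is pulled back along the injective map `SimpleGraph.Adj`. -/
theorem measurableSet_simpleGraph {V : Type*} [Finite V] (A : Set (SimpleGraph V)) :
    MeasurableSet A :=
  ⟨SimpleGraph.Adj '' A, .of_discrete,
    Set.preimage_image_eq A fun _ _ h => SimpleGraph.ext h⟩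

theorem randomCayley_real_le {H : Type*} [AddGroup H] [Fintype H] [DecidableEq H] (p : I)
    (A : Set (SimpleGraph H)) {f : Finset H → ℝ} (hf₀ : ∀ S, 0 ≤ f S)
    (hf : ∀ S : Finset H, SimpleGraph.addCayley (S : Set H) ∈ A → 1 ≤ f S) :
    (randomCayley H p).real A ≤ bernoulliExp (p : ℝ) f := by
  classical
  have hp₀ : (0 : ℝ) ≤ p := p.2.1
  have hp₁ : (0 : ℝ) ≤ 1 - p := sub_nonneg.2 p.2.2
  rw [randomCayley, map_measureReal_apply (measurable_addCayley H)
    (measurableSet_simpleGraph A)]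
  set B := (fun S : Set H => SimpleGraph.addCayley S) ⁻¹' A with hB
  have e : B = ⋃ S ∈ univ.filter (fun S : Finset H => (S : Set H) ∈ B), {(S : Set H)} := by
    ext s
    simp only [mem_filter, mem_univ, true_and, Set.mem_iUnion, Set.mem_singleton_iff, exists_prop]
    constructor
    · intro hs
      exact ⟨s.toFinset, by simpa using hs, by simp⟩
    · rintro ⟨S, hS, rfl⟩
      exact hS
  rw [e, measureReal_biUnion_finset, sum_filter, bernoulliExp]
  · refine sum_le_sum fun S _ => ?_
    have hw : (setBernoulli (Set.univ : Set H) p).real {(S : Set H)} =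
        (p : ℝ) ^ #S * (1 - p : ℝ) ^ #Sᶜ := by
      rw [setBernoulli_real_singleton p (Set.subset_univ _) Set.finite_univ,
        Set.ncard_coe_finset, ← Set.compl_eq_univ_sdiff, ← coe_compl, Set.ncard_coe_finset]
    rw [hw]
    split_ifs with h
    · exact le_mul_of_one_le_right (by positivity) (hf S h)
    · exact mul_nonneg (by positivity) (hf₀ S)
  · intro S _ T _ hST
    simpa [Function.onFun] using hST
  · exact fun S _ => .of_discrete

end

/-! ### Missed vertices are nearly uncorrelated -/

section
open Finset

/-- Reduces to $(1-x)(1+(1+2p)x)\ge1$, that is, $(1+2p)x\le2p$ when $x>0$. It turns the Harris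
product into an exponential. -/
theorem exp_neg_mul_le_one_sub {p x : ℝ} (hx₀ : 0 ≤ x) (hxp : x ≤ p) (hp : p ≤ 1 / 2) :
    Real.exp (-((1 + 2 * p) * x)) ≤ 1 - x := by
  have h := Real.add_one_le_exp ((1 + 2 * p) * x)
  have hpos := Real.exp_pos ((1 + 2 * p) * x)
  rw [Real.exp_neg, inv_le_iff_one_le_mul₀ hpos]
  have hx : 0 ≤ 1 - x := by linarith
  refine le_trans ?_ (mul_le_mul_of_nonneg_left h hx)
  have h₁ : 0 ≤ x * x := mul_nonneg hx₀ hx₀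
  have h₂ : 0 ≤ (1 - x) * x * (p - x) := mul_nonneg (mul_nonneg hx hx₀) (by linarith)
  nlinarith

variable {G : Type*} [AddCommGroup G] [Fintype G] [DecidableEq G]

theorem exp_neg_le_bernoulliExp_avoidInd {p : ℝ} (h₀ : 0 ≤ p) (hp : p ≤ 1 / 2) {d : ℕ} {v : G}
    (hv : v ≠ 0) :
    Real.exp (-((1 + 2 * p) * ∑ T ∈ smallSubsetsWithSum G d v, p ^ #T)) ≤
      bernoulliExp p (avoidInd (smallSubsetsWithSum G d v)) := by
  refine le_trans ?_ (prod_le_bernoulliExp_avoidInd h₀ (by linarith) _)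
  rw [mul_sum, ← sum_neg_distrib, Real.exp_sum]
  refine prod_le_prod (fun _ _ => Real.exp_nonneg _) fun T hT => ?_
  refine exp_neg_mul_le_one_sub (pow_nonneg h₀ _) (pow_le_of_le_one h₀ (by linarith) ?_) hp
  rw [card_ne_zero, nonempty_iff_ne_empty]
  rintro rfl
  exact hv (by simpa using (mem_filter.1 hT).2.2.symm)

/-- Janson above against Harris below. In the exponent, $2^d\cdot2d\kappa$ comes from the dependency
term with two target sums, and $2p$ from the loss in the Harris bound. -/
theorem bernoulliExp_avoidInd_mul_avoidInd_le {p κ M : ℝ} (h₀ : 0 ≤ p) (hp : p ≤ 1 / 2) {d : ℕ}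
    (hd : 2 ≤ d) (hκ : ∀ m ≤ d - 1, (p * Fintype.card G) ^ m ≤ κ * Fintype.card G)
    (hκ₀ : 0 ≤ κ)
    (hM : ∀ v : G, v ≠ 0 → ∑ T ∈ smallSubsetsWithSum G d v, p ^ #T ≤ M) {u v : G} (hu : u ≠ 0)
    (hv : v ≠ 0) (huv : u ≠ v) :
    bernoulliExp p (fun S => avoidInd (smallSubsetsWithSum G d u) S *
        avoidInd (smallSubsetsWithSum G d v) S) ≤
      Real.exp (2 * M * (2 ^ d * (2 * (d * κ)) + 2 * p)) *
        (bernoulliExp p (avoidInd (smallSubsetsWithSum G d u)) *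
          bernoulliExp p (avoidInd (smallSubsetsWithSum G d v))) := by
  set Fu := smallSubsetsWithSum G d u with hFu
  set Fv := smallSubsetsWithSum G d v with hFv
  have hdisj : Disjoint Fu Fv := disjoint_left.2 fun T h₁ h₂ =>
    huv ((mem_filter.1 h₁).2.2.symm.trans (mem_filter.1 h₂).2.2)
  have e : (fun S => avoidInd Fu S * avoidInd Fv S) = avoidInd (Fu ∪ Fv) :=
    funext fun S => (avoidInd_union hdisj S).symm
  have hmem : ∀ T ∈ Fu ∪ Fv, #T ≤ d ∧ ∑ x ∈ T, x ∈ ({u, v} : Finset G) := by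
    intro T hT
    rw [mem_insert, mem_singleton]
    rcases mem_union.1 hT with h | h
    · exact ⟨(mem_filter.1 h).2.1, Or.inl (mem_filter.1 h).2.2⟩
    · exact ⟨(mem_filter.1 h).2.1, Or.inr (mem_filter.1 h).2.2⟩
  have hJ := jansonSum_le h₀ hd hκ (fun T hT => (hmem T hT).1) fun T hT => (hmem T hT).2
  rw [card_pair huv, Nat.cast_two, sum_union hdisj] at hJ
  have hle := bernoulliExp_avoidInd_le h₀ (by linarith) (Fu ∪ Fv)
  rw [sum_union hdisj] at hle
  have hqu := exp_neg_le_bernoulliExp_avoidInd h₀ hp (d := d) hu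
  have hqv := exp_neg_le_bernoulliExp_avoidInd h₀ hp (d := d) hv
  rw [← hFu] at hqu
  rw [← hFv] at hqv
  have hMu := hM u hu
  have hMv := hM v hv
  rw [← hFu] at hMu
  rw [← hFv] at hMv
  have hu₀ : 0 ≤ ∑ T ∈ Fu, p ^ #T := sum_nonneg fun T _ => pow_nonneg h₀ _
  have hv₀ : 0 ≤ ∑ T ∈ Fv, p ^ #T := sum_nonneg fun T _ => pow_nonneg h₀ _
  set mu := ∑ T ∈ Fu, p ^ #T
  set mv := ∑ T ∈ Fv, p ^ #T
  have hcast : ((d - 1 : ℕ) : ℝ) ≤ d := by exact_mod_cast Nat.sub_le d 1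
  set c := (2 : ℝ) ^ d * (2 * (d * κ)) with hc
  have hc₀ : 0 ≤ c := by positivity
  have hJ' : jansonSum p (Fu ∪ Fv) ≤ (mu + mv) * c := by
    refine hJ.trans (mul_le_mul_of_nonneg_left ?_ (by positivity))
    rw [hc]
    gcongr
  rw [e]
  calc bernoulliExp p (avoidInd (Fu ∪ Fv))
      ≤ Real.exp (-(mu + mv) + jansonSum p (Fu ∪ Fv)) := hle
    _ ≤ Real.exp (2 * M * (c + 2 * p) + (-((1 + 2 * p) * mu) + -((1 + 2 * p) * mv))) := by
      refine Real.exp_le_exp.2 ?_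
      have h₁ : (mu + mv) * (c + 2 * p) ≤ 2 * M * (c + 2 * p) :=
        mul_le_mul_of_nonneg_right (by linarith) (by linarith)
      linarith
    _ = Real.exp (2 * M * (c + 2 * p)) *
        (Real.exp (-((1 + 2 * p) * mu)) * Real.exp (-((1 + 2 * p) * mv))) := by
      rw [Real.exp_add, Real.exp_add]
    _ ≤ _ := by
      refine mul_le_mul_of_nonneg_left ?_ (Real.exp_nonneg _)
      exact mul_le_mul hqu hqv (Real.exp_nonneg _) ((Real.exp_nonneg _).trans hqu)

theorem randomCayley_real_ediam_le_le (hG : ∀ x : G, x + x = 0) (hcard : 2 ≤ Fintype.card G)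
    (p : I) {κ M : ℝ} (hp : (p : ℝ) ≤ 1 / 2) {d : ℕ} (hd : 2 ≤ d)
    (hκ : ∀ m ≤ d - 1, ((p : ℝ) * Fintype.card G) ^ m ≤ κ * Fintype.card G) (hκ₀ : 0 ≤ κ)
    (hM₀ : 0 ≤ M)
    (hM : ∀ v : G, v ≠ 0 → ∑ T ∈ smallSubsetsWithSum G d v, (p : ℝ) ^ #T ≤ M) :
    (randomCayley G p).real {Γ | Γ.ediam ≤ d} ≤
      2 * Real.exp ((1 + 2 * p) * M) / Fintype.card G +
        (Real.exp (2 * M * (2 ^ d * (2 * (d * κ)) + 2 * p)) - 1) := by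
  have h₀ : (0 : ℝ) ≤ p := p.2.1
  have h₁ : (p : ℝ) ≤ 1 := p.2.2
  have hcardR : (2 : ℝ) ≤ Fintype.card G := by exact_mod_cast hcard
  set X : G → Finset G → ℝ := fun v => avoidInd (smallSubsetsWithSum G d v) with hX
  -- The vertex $0$ is the empty sum and never missed; $N-1\ge N/2$ others remain.
  have hm : (Fintype.card G : ℝ) / 2 * Real.exp (-((1 + 2 * p) * M)) ≤
      ∑ v ∈ univ.erase (0 : G), bernoulliExp (p : ℝ) (X v) := by
    have hs : #(univ.erase (0 : G)) • Real.exp (-((1 + 2 * p) * M)) ≤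
        ∑ v ∈ univ.erase (0 : G), bernoulliExp (p : ℝ) (X v) := by
      refine card_nsmul_le_sum _ _ _ fun v hv => ?_
      have hv := ne_of_mem_erase hv
      refine le_trans (Real.exp_le_exp.2 ?_) (exp_neg_le_bernoulliExp_avoidInd h₀ hp hv)
      exact neg_le_neg (mul_le_mul_of_nonneg_left (hM v hv) (by linarith))
    refine le_trans ?_ hs
    rw [card_erase_of_mem (mem_univ _), card_univ, nsmul_eq_mul,
      Nat.cast_sub (by lia), Nat.cast_one]
    exact mul_le_mul_of_nonneg_right (by linarith) (Real.exp_nonneg _)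
  have hm₀ : 0 < (Fintype.card G : ℝ) / 2 * Real.exp (-((1 + 2 * p) * M)) := by positivity
  refine (randomCayley_real_le p _ (f := fun S => ∏ v ∈ univ.erase (0 : G), (1 - X v S))
    (fun S => prod_nonneg fun v _ => sub_nonneg.2 (avoidInd_le_one _ S)) fun S hS => ?_).trans ?_
  · refine (prod_eq_one fun v _ => ?_).ge
    rw [hX]
    simp only [avoidInd_smallSubsetsWithSum_eq_zero_of_ediam_le hG hS v, sub_zero]
  · refine (bernoulliExp_prod_one_sub_le h₀ h₁ _ X
      (fun v S => (avoidInd_eq_one_or_zero _ S).imp_left And.right)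
      (δ := Real.exp (2 * M * (2 ^ d * (2 * (d * κ)) + 2 * p)) - 1)
      (sub_nonneg.2 (Real.one_le_exp (by positivity))) (fun u hu v hv huv => ?_)
      (hm₀.trans_le hm)).trans ?_
    · rw [add_sub_cancel]
      exact bernoulliExp_avoidInd_mul_avoidInd_le h₀ hp hd hκ hκ₀ hM (ne_of_mem_erase hu)
        (ne_of_mem_erase hv) huv
    · refine add_le_add_left ((inv_anti₀ hm₀ hm).trans (le_of_eq ?_)) _
      rw [Real.exp_neg]
      field_simp

end

/-! ### Asymptotics of the parameters -/

section

/-- Used with $x=pN$ and $R=N^{1/d}$. If $x\ge R$, lowering the exponent from $d$ to $d-1$ gains at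
least a factor $R$. -/
theorem pow_le_div_mul_of_pow_le {x K R : ℝ} {d m : ℕ} (hx : 0 ≤ x) (hK : 1 ≤ K) (hR : 1 ≤ R)
    (hd : 1 ≤ d) (h : x ^ d ≤ K * R ^ d) (hm : m ≤ d - 1) : x ^ m ≤ K / R * R ^ d := by
  obtain ⟨c, rfl⟩ : ∃ c, d = c + 1 := ⟨d - 1, by lia⟩
  have hR₀ : 0 < R := by linarith
  have e : K / R * R ^ (c + 1) = K * R ^ c := by
    rw [pow_succ]; field_simp
  rw [e]
  rcases le_total x R with hxR | hxR
  · calc x ^ m ≤ R ^ m := by gcongr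
      _ ≤ R ^ c := pow_le_pow_right₀ hR (by lia)
      _ ≤ K * R ^ c := le_mul_of_one_le_left (by positivity) hK
  · refine (pow_le_pow_right₀ (hR.trans hxR) (show m ≤ c by lia)).trans ?_
    refine le_of_mul_le_mul_right ?_ hR₀
    calc x ^ c * R ≤ x ^ c * x := by gcongr
      _ = x ^ (c + 1) := (pow_succ x c).symm
      _ ≤ K * R ^ (c + 1) := h
      _ = _ := by ring

/-- With $l=\log L$ and $s=\sqrt{L/(2l)}$, the factor $2^d d\,d!\le(4d)^d$ is at most $e^{3sl/4}$,
while $N^{1/d}=e^{L/d}\ge e^{2sl}$. The gap $e^{5sl/4}$ absorbs $L^3=e^{3l}$ once $s\ge3$. -/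
theorem two_pow_mul_factorial_div_exp_le {L : ℝ} {d : ℕ} (hd : 1 ≤ d) (hL : 0 < L)
    (hlog : 4 ≤ Real.log L) (hLlog : 18 * Real.log L ≤ L)
    (hdL : (d : ℝ) ≤ √(L / (2 * Real.log L))) :
    2 ^ d * (2 * (d * ((d ! : ℝ) * L / Real.exp (L / d)))) * L ≤ 2 / L := by
  set l := Real.log L with hl
  set s := √(L / (2 * l)) with hs
  have hd₀ : (1 : ℝ) ≤ d := by exact_mod_cast hd
  have hss : s * s = L / (2 * l) := Real.mul_self_sqrt (by positivity)
  have hss' : L = 2 * (s * s) * l := by rw [hss]; field_simp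
  have hs₀ : 0 ≤ s := Real.sqrt_nonneg _
  have hs₃ : 3 ≤ s := by
    have : (3 : ℝ) * 3 ≤ s * s := by
      rw [hss, le_div_iff₀ (by positivity)]
      linarith
    nlinarith
  have hlog4 : Real.log (4 * d) ≤ 3 / 4 * l := by
    have h₁ : (4 * d : ℝ) ^ 2 ≤ 2 * L := by
      have : (d : ℝ) * d ≤ s * s := mul_le_mul hdL hdL (by positivity) hs₀
      have h' : s * s * 8 ≤ L := by nlinarith [mul_nonneg hs₀ hs₀]
      nlinarith
    have h₂ := Real.log_le_log (by positivity) h₁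
    rw [Real.log_pow, Real.log_mul (by norm_num) hL.ne', ← hl] at h₂
    have := Real.log_two_lt_d9
    push_cast at h₂
    linarith
  have hpow : (2 : ℝ) ^ d * (d * d !) ≤ Real.exp (s * (3 / 4 * l)) := by
    have h₁ : (d : ℝ) ≤ 2 ^ d := by exact_mod_cast Nat.lt_two_pow_self.le
    have h₂ : (d ! : ℝ) ≤ (d : ℝ) ^ d := by exact_mod_cast Nat.factorial_le_pow d
    calc (2 : ℝ) ^ d * (d * d !) ≤ 2 ^ d * (2 ^ d * (d : ℝ) ^ d) := by gcongr
      _ = (4 * d : ℝ) ^ d := by rw [← mul_pow, ← mul_pow]; ring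
      _ = Real.exp (d * Real.log (4 * d)) := by
        rw [mul_comm (d : ℝ) (Real.log _), Real.exp_mul, Real.exp_log (by positivity),
          Real.rpow_natCast]
      _ ≤ _ := by
        refine Real.exp_le_exp.2 ?_
        have hl₀ : 0 ≤ 3 / 4 * l := by linarith
        exact (mul_le_mul_of_nonneg_left hlog4 (by positivity)).trans
          (mul_le_mul_of_nonneg_right hdL hl₀)
  have hR : Real.exp (2 * s * l) ≤ Real.exp (L / d) := by
    refine Real.exp_le_exp.2 ?_
    rw [le_div_iff₀ (by positivity)]
    calc 2 * s * l * d ≤ 2 * s * l * s := by gcongr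
      _ = L := by rw [hss']; ring
  have hLe : Real.exp l = L := Real.exp_log hL
  rw [le_div_iff₀ hL]
  calc 2 ^ d * (2 * (d * ((d ! : ℝ) * L / Real.exp (L / d)))) * L * L
      = 2 * (2 ^ d * (d * d !)) * L ^ 3 / Real.exp (L / d) := by ring
    _ ≤ 2 * Real.exp (s * (3 / 4 * l)) * L ^ 3 / Real.exp (2 * s * l) := by gcongr
    _ = 2 * (Real.exp (s * (3 / 4 * l)) * Real.exp (3 * l) / Real.exp (2 * s * l)) := by
      have : Real.exp (3 * l) = L ^ 3 := by
        rw [← hLe, ← Real.exp_nat_mul]; norm_num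
      rw [this]
      ring
    _ ≤ 2 * 1 := by
      refine mul_le_mul_of_nonneg_left ?_ zero_le_two
      rw [← Real.exp_add, ← Real.exp_sub, Real.exp_le_one_iff]
      nlinarith
    _ = 2 := mul_one 2

/-- The bound on the probability of a small diameter vanishes as `log N` grows. -/
theorem tendsto_smallDiameterBound {ε : ℝ} (hε : 0 < ε) :
    Filter.Tendsto (fun L : ℝ => 2 * Real.exp (3 * (2 / L) - ε * L) + (Real.exp (8 * (2 / L)) - 1))
      Filter.atTop (nhds 0) := by
  have h₁ : Filter.Tendsto (fun L : ℝ => 2 / L) Filter.atTop (nhds 0) :=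
    tendsto_const_nhds.div_atTop Filter.tendsto_id
  have h₂ : Filter.Tendsto (fun L : ℝ => Real.exp (8 * (2 / L)) - 1) Filter.atTop (nhds 0) := by
    have := ((Real.continuous_exp.tendsto _).comp (h₁.const_mul 8)).sub_const 1
    simpa using this
  have h₃ : Filter.Tendsto (fun L : ℝ => 3 * (2 / L) - ε * L) Filter.atTop Filter.atBot := by
    have h₄ : Filter.Tendsto (fun L : ℝ => -(ε * L)) Filter.atTop Filter.atBot :=
      Filter.tendsto_neg_atTop_atBot.comp (Filter.tendsto_id.const_mul_atTop hε)
    exact (h₁.const_mul 3).add_atBot h₄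
  have h₅ := ((Real.tendsto_exp_atBot.comp h₃).const_mul 2).add h₂
  simpa using h₅

theorem eventually_le_log_and_mul_log_le :
    ∀ᶠ L : ℝ in Filter.atTop, 1 ≤ L ∧ 4 ≤ Real.log L ∧ 18 * Real.log L ≤ L := by
  have h := Real.isLittleO_log_id_atTop.bound (c := 1 / 18) (by norm_num)
  filter_upwards [Filter.eventually_ge_atTop 1, Real.tendsto_log_atTop.eventually_ge_atTop 4, h]
    with L h₁ h₂ h₃
  refine ⟨h₁, h₂, ?_⟩
  rw [Real.norm_of_nonneg (by linarith), id, Real.norm_of_nonneg (by linarith)] at h₃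
  linarith

end

/-! ### Conclusion for $\mathbb{Z}_2^n$ -/

/-- With $c=2^d\cdot2d\kappa$ one has $2p\le c$, $M=(1-\varepsilon)L+c\le2L$ and $cL\le2/L$. Hence
$(1+2p)M-L\le-\varepsilon L+3cL$ and $2M(c+2p)\le8cL$, which explains the constants $3$ and $8$. -/
theorem randomCayley_zmod_two_real_ediam_le_le {ε L N : ℝ} {n d : ℕ} (hN : N = 2 ^ n)
    (hLN : L = Real.log N) (hε : 0 < ε) (hL : 1 ≤ L) (hlog : 4 ≤ Real.log L)
    (hLlog : 18 * Real.log L ≤ L) (hd : 2 ≤ d) (hdL : (d : ℝ) ≤ √(L / (2 * Real.log L))) (p : I)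
    (hp : (p : ℝ) ^ d ≤ (d ! : ℝ) * (1 - ε) * (L / N ^ (d - 1))) :
    (randomCayley (Fin n → ZMod 2) p).real {Γ | Γ.ediam ≤ d} ≤
      2 * Real.exp (3 * (2 / L) - ε * L) + (Real.exp (8 * (2 / L)) - 1) := by
  have hN₀ : 0 < N := by rw [hN]; positivity
  have hL₀ : 0 < L := by linarith
  have hp₀ : (0 : ℝ) ≤ p := p.2.1
  have hd₀ : (2 : ℝ) ≤ d := by exact_mod_cast hd
  have hf : (1 : ℝ) ≤ d ! := by exact_mod_cast Nat.factorial_pos d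
  have hcard : (Fintype.card (Fin n → ZMod 2) : ℝ) = N := by simp [hN]
  set R := Real.exp (L / d) with hR
  have hR₁ : 1 ≤ R := Real.one_le_exp (by positivity)
  have hRd : R ^ d = N := by
    rw [hR, ← Real.exp_nat_mul, mul_div_cancel₀ _ (by positivity), hLN, Real.exp_log hN₀]
  set K := (d ! : ℝ) * L with hK
  set κ := K / R with hκ
  have hK₁ : 1 ≤ K := one_le_mul_of_one_le_of_one_le hf hL
  have hκ₀ : 0 ≤ κ := by positivity
  have hxd : (p * N) ^ d ≤ (d ! : ℝ) * (1 - ε) * L * N := by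
    calc (p * N) ^ d = (p : ℝ) ^ d * (N ^ (d - 1) * N) := by
          rw [mul_pow, ← pow_succ, Nat.sub_add_cancel (by lia)]
      _ ≤ (d ! : ℝ) * (1 - ε) * (L / N ^ (d - 1)) * (N ^ (d - 1) * N) := by gcongr
      _ = _ := by field_simp
  -- For $\varepsilon>1$ the bound on $p^d$ would be negative, so no $p$ qualifies.
  have hε₁ : 0 ≤ 1 - ε := by
    by_contra! h
    have h₁ : 0 ≤ (d ! : ℝ) * (1 - ε) * L * N := le_trans (by positivity) hxd
    have h₂ : (d ! : ℝ) * L * N * (1 - ε) < 0 := mul_neg_of_pos_of_neg (by positivity) h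
    linarith
  have hpow : ∀ m ≤ d - 1, ((p : ℝ) * Fintype.card (Fin n → ZMod 2)) ^ m ≤
      κ * Fintype.card (Fin n → ZMod 2) := by
    intro m hm
    rw [hcard, hκ, ← hRd]
    refine pow_le_div_mul_of_pow_le (by positivity) hK₁ hR₁ (by lia) ?_ hm
    rw [hRd]
    refine hxd.trans ?_
    rw [hK]
    have : (d ! : ℝ) * (1 - ε) ≤ d ! := mul_le_of_le_one_right (by positivity) (by linarith)
    gcongr
  have hpκ : (p : ℝ) ≤ κ := by
    have h := hpow 1 (by lia)
    rw [hcard, pow_one] at h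
    exact le_of_mul_le_mul_right h hN₀
  set c := (2 : ℝ) ^ d * (2 * (d * κ)) with hc
  have hcL : c * L ≤ 2 / L := two_pow_mul_factorial_div_exp_le (by lia) hL₀ hlog hLlog hdL
  have h2d : (4 : ℝ) ≤ 2 ^ d := by
    calc (4 : ℝ) = 2 ^ 2 := by norm_num
      _ ≤ 2 ^ d := pow_le_pow_right₀ one_le_two hd
  have hcd : 8 * (d * κ) ≤ c := by
    rw [hc]
    have : 0 ≤ d * κ := by positivity
    nlinarith
  have hdκ : 2 * κ ≤ d * κ := mul_le_mul_of_nonneg_right hd₀ hκ₀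
  have hc₀ : 0 ≤ c := by positivity
  have hc₁ : c ≤ c * L := le_mul_of_one_le_right hc₀ hL
  have ht : 2 / L ≤ 1 := by
    rw [div_le_one hL₀]
    linarith
  have hp₂ : 2 * (p : ℝ) ≤ c := by linarith
  set M := (1 - ε) * L + c with hM
  have hεL : (1 - ε) * L ≤ L := mul_le_of_le_one_left hL₀.le (by linarith)
  have hM₀ : 0 ≤ M := by positivity
  have hM₂ : M ≤ 2 * L := by linarith
  have hmu : ∀ v : Fin n → ZMod 2, v ≠ 0 →
      ∑ T ∈ smallSubsetsWithSum (Fin n → ZMod 2) d v, (p : ℝ) ^ T.card ≤ M := by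
    intro v hv
    refine (sum_pow_card_smallSubsetsWithSum_le hp₀ (by lia) hpow hv).trans ?_
    rw [hcard, hM]
    refine add_le_add ?_ ?_
    · rw [div_le_iff₀ (by positivity)]
      linarith
    · have : ((d - 1 : ℕ) : ℝ) ≤ d := by exact_mod_cast Nat.sub_le d 1
      have := mul_le_mul_of_nonneg_right this hκ₀
      linarith
  have htwo : ∀ x : Fin n → ZMod 2, x + x = 0 := fun x =>
    funext fun i => CharTwo.add_self_eq_zero (x i)
  have hcard₂ : 2 ≤ Fintype.card (Fin n → ZMod 2) := by
    have h : (1 : ℝ) < N := by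
      rw [← hRd]
      refine one_lt_pow₀ (Real.one_lt_exp_iff.2 (by positivity)) (by lia)
    rw [← hcard] at h
    exact_mod_cast h
  refine (randomCayley_real_ediam_le_le htwo hcard₂ p (κ := κ) (M := M) (by linarith) hd hpow hκ₀
    hM₀ hmu).trans ?_
  refine add_le_add ?_ (sub_le_sub_right (Real.exp_le_exp.2 ?_) 1)
  · rw [hcard, mul_div_assoc]
    refine mul_le_mul_of_nonneg_left ?_ zero_le_two
    have hNe : N = Real.exp L := by rw [hLN, Real.exp_log hN₀]
    rw [hNe, ← Real.exp_sub]
    refine Real.exp_le_exp.2 ?_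
    have h₁ : 2 * (p : ℝ) * M ≤ c * (2 * L) := mul_le_mul hp₂ hM₂ hM₀ hc₀
    rw [hM] at h₁ ⊢
    linarith
  · have h₁ : 2 * M * (c + 2 * p) ≤ (4 * L) * (c + c) :=
      mul_le_mul (by linarith) (by linarith) (by positivity) (by linarith)
    linarith

theorem diamBound_le {γ N : ℝ} (hγ : 0 ≤ γ) :
    diamBound γ N ≤ √(Real.log N / (2 * Real.log (Real.log N))) :=
  mul_le_of_le_one_left (Real.sqrt_nonneg _) (by linarith)

/-- With high probability means: the probability is at least `1 - η` as soon as `n ≥ n₀`, where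
`n₀` depends only on `ε`, `γ` and `η`. The condition on `p` is the one obtained by raising
`p ≤ (d! (1 - ε) log N / N ^ (d - 1)) ^ (1 / d)` to the power `d`. The diameter of a disconnected
graph is `⊤`. -/
theorem theorem4 (ε : ℝ) (hε : 0 < ε) (γ : ℝ) (hγ₀ : 0 < γ) (hγ₁ : γ < 1) :
    ∀ η : ℝ, 0 < η → ∃ n₀ : ℕ, ∀ n : ℕ, n₀ ≤ n → ∀ N : ℝ, N = 2 ^ n →
      ∀ d : ℕ, 2 ≤ d → (d : ℝ) ≤ diamBound γ N →
        ∀ p : unitInterval,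
          (p : ℝ) ^ d ≤ (d ! : ℝ) * (1 - ε) * (Real.log N / N ^ (d - 1)) →
            1 - η ≤ (randomCayley (Fin n → ZMod 2) p).real
              {Γ : SimpleGraph (Fin n → ZMod 2) | (d : ℕ∞) < Γ.ediam} := by
  intro η hη
  have hL : Filter.Tendsto (fun n : ℕ => Real.log (2 ^ n)) Filter.atTop Filter.atTop := by
    simp only [Real.log_pow]
    exact tendsto_natCast_atTop_atTop.atTop_mul_const (Real.log_pos one_lt_two)
  obtain ⟨n₀, hn₀⟩ := Filter.eventually_atTop.1 <| hL.eventually <|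
    eventually_le_log_and_mul_log_le.and
      ((tendsto_smallDiameterBound hε).eventually_le_const hη)
  refine ⟨n₀, fun n hn N hN d hd hdN p hp => ?_⟩
  obtain ⟨⟨hL₁, hL₂, hL₃⟩, hbound⟩ := hn₀ n hn
  rw [← hN] at hL₁ hL₂ hL₃ hbound
  have h := (randomCayley_zmod_two_real_ediam_le_le hN rfl hε hL₁ hL₂ hL₃ hd
    (hdN.trans (diamBound_le hγ₀.le)) p hp).trans hbound
  have hcompl : {Γ : SimpleGraph (Fin n → ZMod 2) | (d : ℕ∞) < Γ.ediam} =
      {Γ : SimpleGraph (Fin n → ZMod 2) | Γ.ediam ≤ (d : ℕ∞)}ᶜ := by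
    ext Γ
    simp
  rw [hcompl, probReal_compl_eq_one_sub (measurableSet_simpleGraph _)]
  linarith
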